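/- **Setting.** Let $\mathcal U$ be a real separable Hilbert space with orthonormal basis $\{\mathfrak u_k\}$, and let $\dot W=\{\dot W(h),\,h\in\mathcal U\}$ be a zero-mean Gaussian family with $\mathbb E\big(\dot W(h_1)\dot W(h_2)\big)=(h_1,h_2)_{\mathcal U}$ on a probability space $\mathbb F=(\Omega,\mathcal F,\mathbb P)$, where $\mathcal F$ is generated by $\dot W$ up to null sets. Let $\boldsymbol\delta$ be the Skorokhod integral (the adjoint of the Malliavin derivative on $L_2(\mathbb F)$), and let $\boldsymbol\delta^{\hat\otimes k}$ be its $k$-fold iteration on square-integrable random elements of $\mathcal U^{\otimes k}$. Let $Q=\{q_k\}$ be a sequence with $q_k\ge 1$ for all $k$, let $r\in\mathbb R$, and let $\Lambda_Q^r$ be the self-adjoint operator $\Lambda_Q^r\mathfrak u_k=q_k^r\mathfrak u_k$ on $\mathcal U$, extended to tensor powers by $\Lambda_Q^r(\mathfrak u_{i_1}\otimes\cdots\otimes\mathfrak u_{i_n})=q_{i_1}^r\cdots q_{i_n}^r\,\mathfrak u_{i_1}\otimes\cdots\otimes\mathfrak u_{i_n}$. Put $\|f\|_{Q,r}=\|\Lambda_Q^rf\|$,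 with the value $+\infty$ if $f$ is not in the domain of $\Lambda_Q^r$. The space $(\mathcal L)_{Q,r}(\mathbb F)$ is the closure of the set of random variables $$\eta=\eta_0+\sum_{k=1}^N\frac1{k!}\,\boldsymbol\delta^{\hat\otimes k}(\eta_k),$$ where $\eta_0\in\mathbb R$ and each $\eta_k$ belongs to the symmetric tensor power $\mathcal U^{\hat\otimes k}$ and to the domain of $\Lambda_Q^r$, in the norm $$\|\eta\|^2=|\eta_0|^2+\sum_{k=1}^N\frac1{(k!)^2}\|\eta_k\|_{Q,r}^2 .$$ The space $(\mathcal L)^{Q,r}(\mathbb F)$ is the dual of $(\mathcal L)_{Q,r}(\mathbb F)$ relative to the inner product of $L_2(\mathbb F)$. Thus $\zeta\in L_2(\mathbb F)$ belongs to it if and only if the functional $\eta\mapsto\mathbb E(\eta\zeta)$, defined on the above set, is bounded in the above norm. **Proposition 3.1.** For every $h\in\mathcal U$, the stochastic exponential $$\mathcal E_h=\exp\Big(\dot W(h)-\tfrac12\|h\|_{\mathcal U}^2\Big)$$ belongs to $(\mathcal L)^{Q,r}(\mathbb F)$ if and only if $\|h\|_{Q,-r}<1$ (in particular, $h$ is then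 in the domain of $\Lambda_Q^{-r}$). -/

import Mathlib

open MeasureTheory ProbabilityTheory
open scoped ENNReal NNReal

namespace WhiteNoise

noncomputable section

/-- `W = {W(h), h ∈ U}` is an isonormal (white noise) Gaussian family on the probability space
`(Ω, mΩ, P)`: jointly Gaussian, zero mean, `E (W(h₁) W(h₂)) = (h₁, h₂)`, and `mΩ` is the
σ-algebra generated by the `W(h)`, up to `P`-null sets (so that the generated σ-algebra
itself and its completion are both allowed). -/
structure IsWhiteNoise {Ω : Type*} [mΩ : MeasurableSpace Ω] {U : Type*} [NormedAddCommGroup U]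
    [InnerProductSpace ℝ U] (P : Measure Ω) (W : U → Ω → ℝ) : Prop where
  measurable : ∀ h, Measurable (W h)
  gaussian : IsGaussianProcess W P
  mean_zero : ∀ h, ∫ ω, W h ω ∂P = 0
  covariance : ∀ h₁ h₂, ∫ ω, W h₁ ω * W h₂ ω ∂P = inner ℝ h₁ h₂
  generates : ∀ A, MeasurableSet A →
    ∃ B, MeasurableSet[⨆ h, MeasurableSpace.comap (W h) inferInstance] B ∧ A =ᵐ[P] B

/-- The weight sequences: `q k ≥ 1` for all `k`. -/
def IsWeight {ι : Type*} (q : ι → ℝ) : Prop := ∀ k, 1 ≤ q k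

/-! ### Hilbert tensor powers of `U`

The Hilbert tensor power `U^{⊗n}` is realised as the space of Hilbert-Schmidt `n`-linear forms:
a tensor `T` is identified with the form `(x₁,…,xₙ) ↦ (T, x₁ ⊗ ⋯ ⊗ xₙ)`. Its coordinates in the
product orthonormal basis are the numbers `T(u_{i₁},…,u_{iₙ})`, and `T` is a tensor exactly when
they are square summable. -/

/-- Continuous `n`-linear forms on `U`. -/
abbrev Form (U : Type*) [NormedAddCommGroup U] [InnerProductSpace ℝ U] (n : ℕ) : Type _ :=
  ContinuousMultilinearMap ℝ (fun _ : Fin n => U) ℝ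

variable {Ω : Type*} [MeasurableSpace Ω] {U : Type*} [NormedAddCommGroup U]
  [InnerProductSpace ℝ U] {ι : Type*}

/-- `‖T‖²_{Q,r} = ‖Λ_Q^r T‖²` in `U^{⊗n}`, where `Λ_Q^r` multiplies the coordinate of
`u_{i₁} ⊗ ⋯ ⊗ u_{iₙ}` by `q_{i₁}^r ⋯ q_{iₙ}^r`. For a tensor `T` the value is `∞` exactly when `T`
is not in the domain of `Λ_Q^r`. -/
def weightedSq (b : HilbertBasis ι ℝ U) (q : ι → ℝ) (r : ℝ) {n : ℕ} (T : Form U n) : ℝ≥0∞ :=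
  ∑' i : Fin n → ι, ENNReal.ofReal (((∏ j, q (i j) ^ r) * T (fun j => b (i j))) ^ 2)

/-- The squared norm `‖T‖²` in `U^{⊗n}`; it is `∞` when `T` is not Hilbert-Schmidt. -/
def tensorSq (b : HilbertBasis ι ℝ U) {n : ℕ} (T : Form U n) : ℝ≥0∞ :=
  ∑' i : Fin n → ι, ENNReal.ofReal (T (fun j => b (i j)) ^ 2)

/-- `‖h‖_{Q,r} = ‖Λ_Q^r h‖` for `h ∈ U`, where `Λ_Q u_k = q_k u_k`; it is `∞` exactly when `h` is
not in the domain of `Λ_Q^r`. -/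
def normQ (b : HilbertBasis ι ℝ U) (q : ι → ℝ) (r : ℝ) (h : U) : ℝ≥0∞ :=
  (∑' k, ENNReal.ofReal ((q k ^ r * inner ℝ (b k) h) ^ 2)) ^ (1 / 2 : ℝ)

/-- `T` belongs to the symmetric tensor power `U^{⊗̂n}` and to the domain of `Λ_Q^r`. -/
def IsKernel (b : HilbertBasis ι ℝ U) (q : ι → ℝ) (r : ℝ) {n : ℕ} (T : Form U n) : Prop :=
  (∀ (σ : Equiv.Perm (Fin n)) (x : Fin n → U), T (fun j => x (σ j)) = T x) ∧
    tensorSq b T < ∞ ∧ weightedSq b q r T < ∞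

/-- `G` is a square integrable random element of `U^{⊗n}`. -/
def IsL2Tensor (P : Measure Ω) (b : HilbertBasis ι ℝ U) {n : ℕ} (G : Ω → Form U n) : Prop :=
  (∀ x, AEStronglyMeasurable (fun ω => G ω x) P) ∧ ∫⁻ ω, tensorSq b (G ω) ∂P < ∞

/-! ### The Malliavin derivative and the Skorokhod integral -/

/-- The smooth random variable `f(W(h₁),…,W(h_N))`. -/
def cylinder (W : U → Ω → ℝ) {N : ℕ} (f : (Fin N → ℝ) → ℝ) (h : Fin N → U) (ω : Ω) : ℝ :=
  f (fun i => W (h i) ω)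

/-- The derivative `∑ᵢ ∂ᵢf(W(h₁),…,W(h_N)) hᵢ` of a smooth random variable. -/
def cylinderDeriv (W : U → Ω → ℝ) {N : ℕ} (f : (Fin N → ℝ) → ℝ) (h : Fin N → U) (ω : Ω) : U :=
  ∑ i, (fderiv ℝ f (fun j => W (h j) ω) (Pi.single i 1)) • h i

/-- `φ` is in the domain `𝔻^{1,2}` of the Malliavin derivative on `L₂`, with derivative `Dφ`. The
operator is the closure of the derivative of smooth random variables `f(W(h₁),…,W(h_N))`, where
`f` is smooth and all its partial derivatives have polynomial growth. -/
def IsMalliavinDeriv (P : Measure Ω) (W : U → Ω → ℝ) (φ : Ω → ℝ) (Dφ : Ω → U) : Prop :=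
  MemLp φ 2 P ∧ MemLp Dφ 2 P ∧
    ∀ ε : ℝ≥0∞, 0 < ε → ∃ (N : ℕ) (f : (Fin N → ℝ) → ℝ) (h : Fin N → U),
      f.HasTemperateGrowth ∧
        eLpNorm (fun ω => φ ω - cylinder W f h ω) 2 P < ε ∧
        eLpNorm (fun ω => Dφ ω - cylinderDeriv W f h ω) 2 P < ε

/-- `g = δ(G)`: the Skorokhod integral of a square integrable `X ⊗ U`-valued random element `G` is
the square integrable `X`-valued `g` with `E (φ g) = E (G, Dφ)_U` for all `φ ∈ 𝔻^{1,2}`. Here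
`X = U^{⊗n}`, the identity in `X` is tested against the elementary tensors `x₁ ⊗ ⋯ ⊗ xₙ`, which
span a dense subspace, and `U` is the last factor of `U^{⊗(n+1)}`. -/
def IsSkorokhod (P : Measure Ω) (W : U → Ω → ℝ) (b : HilbertBasis ι ℝ U) {n : ℕ}
    (G : Ω → Form U (n + 1)) (g : Ω → Form U n) : Prop :=
  IsL2Tensor P b G ∧ IsL2Tensor P b g ∧
    ∀ (φ : Ω → ℝ) (Dφ : Ω → U), IsMalliavinDeriv P W φ Dφ → ∀ x : Fin n → U,
      ∫ ω, φ ω * g ω x ∂P = ∫ ω, G ω (Fin.snoc (α := fun _ => U) x (Dφ ω)) ∂P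

/-- `g = δ^{⊗̂n}(G)`, the `n`-fold iterated Skorokhod integral; for `n = 0` the space `U^{⊗0}` is
`ℝ` and `δ^{⊗̂0}` is the identity. -/
def IsIteratedSkorokhod (P : Measure Ω) (W : U → Ω → ℝ) (b : HilbertBasis ι ℝ U) :
    (n : ℕ) → (Ω → Form U n) → (Ω → ℝ) → Prop
  | 0, G, g => MemLp g 2 P ∧ ∀ᵐ ω ∂P, g ω = G ω Fin.elim0
  | n + 1, G, g => ∃ G' : Ω → Form U n, IsSkorokhod P W b G G' ∧ IsIteratedSkorokhod P W b n G' g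

/-! ### The spaces `(L)_{Q,r}` and `(L)^{Q,r}` -/

/-- `Y = η₀ + ∑_{k=1}^N (1/k!) δ^{⊗̂k}(η_k)` with `η_k ∈ U^{⊗̂k}` in the domain of `Λ_Q^r`. These
`Y` are the dense subspace whose closure in the norm `chaosNorm` is `(L)_{Q,r}`. -/
def IsFiniteChaos (P : Measure Ω) (W : U → Ω → ℝ) (b : HilbertBasis ι ℝ U) (q : ι → ℝ) (r : ℝ)
    (N : ℕ) (η : (k : ℕ) → Form U k) (Y : Ω → ℝ) : Prop :=
  (∀ k ≤ N, IsKernel b q r (η k)) ∧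
    ∃ g : ℕ → Ω → ℝ, (∀ k ≤ N, IsIteratedSkorokhod P W b k (fun _ => η k) (g k)) ∧
      ∀ᵐ ω ∂P, Y ω = ∑ k ∈ Finset.range (N + 1), (1 / (k.factorial : ℝ)) * g k ω

/-- The norm of `(L)_{Q,r}`:
`‖η₀ + ∑_{k=1}^N (1/k!) δ^{⊗̂k}(η_k)‖² = |η₀|² + ∑_{k=1}^N (1/k!)² ‖η_k‖²_{Q,r}`. -/
def chaosNorm (b : HilbertBasis ι ℝ U) (q : ι → ℝ) (r : ℝ) (N : ℕ)
    (η : (k : ℕ) → Form U k) : ℝ≥0∞ :=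
  (∑ k ∈ Finset.range (N + 1),
    ENNReal.ofReal ((1 / (k.factorial : ℝ)) ^ 2) * weightedSq b q r (η k)) ^ (1 / 2 : ℝ)

/-- The random variable `ζ ∈ L₂` belongs to `(L)^{Q,r}`, the dual of `(L)_{Q,r}` relative to the
inner product of `L₂`: the functional `Y ↦ E (Y ζ)`, defined on the dense subspace of finite
chaos expansions, is bounded in the norm of `(L)_{Q,r}`, that is, it extends to a (unique)
continuous linear functional on the closure `(L)_{Q,r}`. -/
def MemDual (P : Measure Ω) (W : U → Ω → ℝ) (b : HilbertBasis ι ℝ U) (q : ι → ℝ) (r : ℝ)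
    (ζ : Ω → ℝ) : Prop :=
  MemLp ζ 2 P ∧ ∃ C : ℝ≥0, ∀ (N : ℕ) (η : (k : ℕ) → Form U k) (Y : Ω → ℝ),
    IsFiniteChaos P W b q r N η Y →
      ENNReal.ofReal |∫ ω, Y ω * ζ ω ∂P| ≤ C * chaosNorm b q r N η

/-- The stochastic exponential `exp(W(h) - ‖h‖²/2)`. -/
def stochExp (W : U → Ω → ℝ) (h : U) (ω : Ω) : ℝ := Real.exp (W h ω - ‖h‖ ^ 2 / 2)

end

end WhiteNoise

/-! Since D𝓔_h = 𝓔_h h, testing the Skorokhod adjointness against 𝓔_h fills one slot of the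
integrand with h and gives back 𝓔_h. After n steps, with E 𝓔_h = 1, a constant kernel T contributes
T(h,…,h). So the functional is Y ↦ ∑ (1/k!) η_k(h,…,h)
(`IsWhiteNoise.integral_finiteChaos_mul_stochExp`).

Put a = ‖h‖²_{Q,-r}. Cauchy–Schwarz over coordinates gives T(h,…,h)² ≤ ‖T‖²_{Q,r} aⁿ
(`ofReal_sq_diagonal_le`). A second Cauchy–Schwarz, over k, bounds the functional by (∑ aᵏ)^{1/2},
which is finite when a < 1.

Conversely, the kernels k! u^{⊗k}, with u a finite truncation of Λ_Q^{-2r}h, attain equality in both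
estimates, so boundedness forces every partial sum of ∑ aᵏ below C², hence a < 1. This test needs
the iterated integrals of u^{⊗k} to exist. They are Hermite polynomials in W(u), obtained from
Gaussian integration by parts (`IsWhiteNoise.isIteratedSkorokhod_powForm`). -/

namespace WhiteNoise

/-! ### Tensor powers and the diagonal Cauchy–Schwarz bound -/

section Tensor

variable {U : Type*} [NormedAddCommGroup U] [InnerProductSpace ℝ U] {ι : Type*}

theorem tsum_prod_eq_pow (f : ι → ℝ≥0∞) (n : ℕ) :
    ∑' i : Fin n → ι, ∏ j, f (i j) = (∑' k, f k) ^ n := by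
  induction n with
  | zero => simp
  | succ n ih =>
    rw [← (Fin.consEquiv (fun _ : Fin (n + 1) => ι)).tsum_eq, ENNReal.tsum_prod']
    simp only [Fin.consEquiv_apply, Fin.prod_univ_succ, Fin.cons_zero, Fin.cons_succ,
      ENNReal.tsum_mul_left, ENNReal.tsum_mul_right]
    rw [ih, pow_succ']

/-- The elementary symmetric tensor `u ⊗ ⋯ ⊗ u`. -/
noncomputable def powForm (u : U) (n : ℕ) : Form U n :=
  (ContinuousMultilinearMap.mkPiAlgebra ℝ (Fin n) ℝ).compContinuousLinearMap
    (fun _ => innerSL ℝ u)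

theorem powForm_apply (u : U) (n : ℕ) (x : Fin n → U) :
    powForm u n x = ∏ j, inner ℝ u (x j) := by
  simp [powForm]

theorem powForm_snoc (u : U) (n : ℕ) (x : Fin n → U) (y : U) :
    powForm u (n + 1) (Fin.snoc (α := fun _ => U) x y) = powForm u n x * inner ℝ u y := by
  simp [powForm_apply, Fin.prod_univ_castSucc]

theorem weightedSq_smul_powForm (b : HilbertBasis ι ℝ U) (q : ι → ℝ) (r c : ℝ) (u : U) (n : ℕ) :
    weightedSq b q r (c • powForm u n) =
      ENNReal.ofReal (c ^ 2) *
        (∑' k, ENNReal.ofReal ((q k ^ r * inner ℝ u (b k)) ^ 2)) ^ n := by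
  rw [← tsum_prod_eq_pow, ← ENNReal.tsum_mul_left, weightedSq]
  congr 1 with i
  rw [← ENNReal.ofReal_prod_of_nonneg (fun _ _ => sq_nonneg _),
    ← ENNReal.ofReal_mul (sq_nonneg _), smul_apply, powForm_apply,
    Finset.prod_pow, Finset.prod_mul_distrib, smul_eq_mul]
  ring_nf

theorem tensorSq_eq_weightedSq (b : HilbertBasis ι ℝ U) {n : ℕ} (T : Form U n) :
    tensorSq b T = weightedSq b 1 0 T := by
  simp [tensorSq, weightedSq]

theorem tsum_inner_sq (b : HilbertBasis ι ℝ U) (u : U) :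
    ∑' k, ENNReal.ofReal (inner ℝ u (b k) ^ 2) = ENNReal.ofReal (‖u‖ ^ 2) := by
  have hs := b.hasSum_inner_mul_inner u u
  have he : ∀ k, inner ℝ u (b k) * inner ℝ (b k) u = inner ℝ u (b k) ^ 2 := fun k => by
    rw [real_inner_comm u (b k), sq]
  simp only [he, real_inner_self_eq_norm_sq] at hs
  rw [← ENNReal.ofReal_tsum_of_nonneg (fun _ => sq_nonneg _) hs.summable, hs.tsum_eq]

theorem tensorSq_smul_powForm (b : HilbertBasis ι ℝ U) (c : ℝ) (u : U) (n : ℕ) :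
    tensorSq b (c • powForm u n) = ENNReal.ofReal (c ^ 2) * ENNReal.ofReal (‖u‖ ^ 2) ^ n := by
  rw [tensorSq_eq_weightedSq, weightedSq_smul_powForm]
  simp [tsum_inner_sq]

theorem isKernel_smul_powForm (b : HilbertBasis ι ℝ U) (q : ι → ℝ) (r c : ℝ) (u : U) (n : ℕ)
    (hu : ∑' k, ENNReal.ofReal ((q k ^ r * inner ℝ u (b k)) ^ 2) < ∞) :
    IsKernel b q r (c • powForm u n) := by
  refine ⟨fun σ x => ?_, ?_, ?_⟩
  · simp only [smul_apply, powForm_apply]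
    rw [Equiv.prod_comp σ (fun j => inner ℝ u (x j))]
  · rw [tensorSq_smul_powForm]
    exact ENNReal.mul_lt_top ENNReal.ofReal_lt_top (ENNReal.pow_lt_top ENNReal.ofReal_lt_top)
  · rw [weightedSq_smul_powForm]
    exact ENNReal.mul_lt_top ENNReal.ofReal_lt_top (ENNReal.pow_lt_top hu)

/-- Cauchy–Schwarz between the coordinates of Λ_Q^r T and those of (Λ_Q^{-r}h)^{⊗n}. It is applied
to finite partial sums of h, where everything is finite; continuity of T gives the limit, so neither
factor need be finite. -/
theorem ofReal_sq_diagonal_le (b : HilbertBasis ι ℝ U) {q : ι → ℝ} (hq : ∀ k, 0 < q k) (r : ℝ)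
    {n : ℕ} (T : Form U n) (h : U) :
    ENNReal.ofReal (T (fun _ => h) ^ 2) ≤
      weightedSq b q r T * (∑' k, ENNReal.ofReal ((q k ^ (-r) * inner ℝ (b k) h) ^ 2)) ^ n := by
  classical
  have hlim : Filter.Tendsto (fun s : Finset ι => ENNReal.ofReal
      (T (fun _ => ∑ k ∈ s, (inner ℝ (b k) h : ℝ) • b k) ^ 2)) Filter.atTop
      (nhds (ENNReal.ofReal (T (fun _ => h) ^ 2))) := by
    have hs : HasSum (fun k => (inner ℝ (b k) h : ℝ) • b k) h := by
      simpa [HilbertBasis.repr_apply_apply] using b.hasSum_repr h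
    have hc : Continuous fun y : U => ENNReal.ofReal (T (fun _ => y) ^ 2) :=
      ENNReal.continuous_ofReal.comp
        ((T.cont.comp (continuous_pi fun _ => continuous_id)).pow 2)
    exact (hc.tendsto h).comp hs
  refine le_of_tendsto' hlim fun s => ?_
  -- Multilinear expansion, with the factor 1 = q^r q^{-r} inserted in each slot.
  have hexp : T (fun _ => ∑ k ∈ s, (inner ℝ (b k) h : ℝ) • b k) =
      ∑ i ∈ Fintype.piFinset (fun _ : Fin n => s),
        ((∏ j, q (i j) ^ r) * T (fun j => b (i j))) *
          ∏ j, q (i j) ^ (-r) * inner ℝ (b (i j)) h := by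
    rw [ContinuousMultilinearMap.map_sum_finset]
    refine Finset.sum_congr rfl fun i _ => ?_
    rw [ContinuousMultilinearMap.map_smul_univ, Finset.prod_mul_distrib, smul_eq_mul]
    have h1 : (∏ j, q (i j) ^ r) * ∏ j, q (i j) ^ (-r) = 1 := by
      rw [← Finset.prod_mul_distrib]
      refine Finset.prod_eq_one fun j _ => ?_
      rw [← Real.rpow_add (hq _), add_neg_cancel, Real.rpow_zero]
    linear_combination
      (-(∏ j, inner ℝ (b (i j)) h) * T (fun j => b (i j))) * h1
  rw [hexp]
  refine (ENNReal.ofReal_le_ofReal (Finset.sum_mul_sq_le_sq_mul_sq _ _ _)).trans ?_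
  rw [ENNReal.ofReal_mul (Finset.sum_nonneg fun _ _ => sq_nonneg _),
    ENNReal.ofReal_sum_of_nonneg (fun _ _ => sq_nonneg _),
    ENNReal.ofReal_sum_of_nonneg (fun _ _ => sq_nonneg _), ← tsum_prod_eq_pow]
  gcongr
  · exact ENNReal.sum_le_tsum _
  · refine le_trans (le_of_eq ?_) (ENNReal.sum_le_tsum (Fintype.piFinset fun _ : Fin n => s))
    refine Finset.sum_congr rfl fun i _ => ?_
    rw [← ENNReal.ofReal_prod_of_nonneg (fun _ _ => sq_nonneg _), Finset.prod_pow]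

end Tensor

/-! ### The stochastic exponential and its pairing with iterated integrals -/

section StochExp

variable {Ω : Type*} [MeasurableSpace Ω] {P : Measure Ω}
  {U : Type*} [NormedAddCommGroup U] [InnerProductSpace ℝ U] {ι : Type*} {W : U → Ω → ℝ}

theorem IsWhiteNoise.map_eq (hW : IsWhiteNoise P W) (h : U) :
    P.map (W h) = gaussianReal 0 (‖h‖ ^ 2).toNNReal := by
  have hg := hW.gaussian.hasGaussianLaw_eval h
  rw [hg.map_eq_gaussianReal, hW.mean_zero,
    variance_of_integral_eq_zero hg.aemeasurable (hW.mean_zero h)]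
  congr 2
  have := hW.covariance h h
  rw [real_inner_self_eq_norm_sq] at this
  rw [← this]
  simp [sq]

theorem IsWhiteNoise.integrable_exp (hW : IsWhiteNoise P W) (h : U) (t : ℝ) :
    Integrable (fun ω => Real.exp (t * W h ω)) P := by
  have := integrable_exp_mul_gaussianReal (μ := 0) (v := (‖h‖ ^ 2).toNNReal) t
  rw [← hW.map_eq h] at this
  exact this.comp_measurable (hW.measurable h)

theorem IsWhiteNoise.memLp_exp (hW : IsWhiteNoise P W) (h : U) (t : ℝ) :
    MemLp (fun ω => Real.exp (t * W h ω)) 2 P := by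
  have hm := hW.measurable h
  rw [memLp_two_iff_integrable_sq (by fun_prop)]
  convert! hW.integrable_exp h (2 * t) using 2 with ω
  rw [← Real.exp_nat_mul]
  push_cast
  ring_nf

theorem IsWhiteNoise.memLp_exp_abs (hW : IsWhiteNoise P W) (h : U) :
    MemLp (fun ω => Real.exp |W h ω|) 2 P := by
  have hm := hW.measurable h
  refine ((hW.memLp_exp h 1).add (hW.memLp_exp h (-1))).mono (by fun_prop)
    (ae_of_all _ fun ω => ?_)
  simp only [Pi.add_apply, Real.norm_eq_abs]
  rw [abs_of_pos (Real.exp_pos _), one_mul, neg_one_mul,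
    abs_of_pos (add_pos (Real.exp_pos _) (Real.exp_pos _))]
  rcases abs_choice (W h ω) with h1 | h1 <;> rw [h1] <;>
    linarith [Real.exp_pos (W h ω), Real.exp_pos (-W h ω)]

theorem IsWhiteNoise.memLp_stochExp (hW : IsWhiteNoise P W) (h : U) :
    MemLp (stochExp W h) 2 P := by
  convert! (hW.memLp_exp h 1).const_mul (Real.exp (-(‖h‖ ^ 2 / 2))) using 2 with ω
  rw [stochExp, ← Real.exp_add]
  ring_nf

theorem IsWhiteNoise.integral_stochExp (hW : IsWhiteNoise P W) (h : U) :
    ∫ ω, stochExp W h ω ∂P = 1 := by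
  have := mgf_gaussianReal (hW.map_eq h) 1
  simp only [mgf, one_mul, Real.coe_toNNReal _ (sq_nonneg ‖h‖)] at this
  have he : ∀ ω, stochExp W h ω = Real.exp (-(‖h‖ ^ 2 / 2)) * Real.exp (W h ω) := fun ω => by
    rw [stochExp, ← Real.exp_add]
    ring_nf
  simp_rw [he]
  rw [integral_const_mul, this, ← Real.exp_add]
  simp

/-- The Taylor polynomials of the exponential function. -/
noncomputable def expTaylor (m : ℕ) (x : ℝ) : ℝ :=
  ∑ k ∈ Finset.range m, x ^ k / (k.factorial : ℝ)

theorem tendsto_expTaylor (x : ℝ) :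
    Filter.Tendsto (fun m => expTaylor m x) Filter.atTop (nhds (Real.exp x)) := by
  rw [Real.exp_eq_exp_ℝ]
  exact (NormedSpace.expSeries_div_hasSum_exp x).tendsto_sum_nat

theorem abs_expTaylor_le (m : ℕ) (x : ℝ) : |expTaylor m x| ≤ Real.exp |x| := by
  refine (Finset.abs_sum_le_sum_abs _ _).trans ?_
  refine le_trans (le_of_eq ?_) (Real.sum_le_exp_of_nonneg (abs_nonneg x) m)
  refine Finset.sum_congr rfl fun k _ => ?_
  rw [abs_div, abs_pow, Nat.abs_cast]

theorem hasTemperateGrowth_expTaylor (m : ℕ) : (expTaylor m).HasTemperateGrowth := by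
  unfold expTaylor
  simp only [div_eq_mul_inv]
  fun_prop

theorem hasDerivAt_expTaylor (m : ℕ) (x : ℝ) :
    HasDerivAt (expTaylor (m + 1)) (expTaylor m x) x := by
  unfold expTaylor
  have h : HasDerivAt (fun x : ℝ => ∑ k ∈ Finset.range (m + 1), x ^ k / (k.factorial : ℝ))
      (∑ k ∈ Finset.range (m + 1), (k * x ^ (k - 1)) / (k.factorial : ℝ)) x :=
    HasDerivAt.fun_sum fun k _ => (hasDerivAt_pow k x).div_const _
  convert! h using 1
  rw [Finset.sum_range_succ']
  simp only [Nat.cast_zero, zero_mul, zero_div, add_zero, Nat.add_sub_cancel]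
  refine Finset.sum_congr rfl fun k _ => ?_
  rw [Nat.factorial_succ]
  push_cast
  field_simp

/-- Dominated convergence: every Taylor polynomial is at most exp|x| in modulus, and exp|W(h)| is
square integrable. -/
theorem IsWhiteNoise.tendsto_eLpNorm_expTaylor (hW : IsWhiteNoise P W) (h : U) :
    Filter.Tendsto (fun m => eLpNorm (fun ω => Real.exp (W h ω) - expTaylor m (W h ω)) 2 P)
      Filter.atTop (nhds 0) := by
  have hm := hW.measurable h
  have hc : ∀ m, Continuous (expTaylor m) := fun m => (hasTemperateGrowth_expTaylor m).1.continuous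
  have hlim : Filter.Tendsto (fun m => ∫⁻ ω,
      ‖Real.exp (W h ω) - expTaylor m (W h ω)‖ₑ ^ (2 : ℝ) ∂P) Filter.atTop
      (nhds (∫⁻ _, 0 ∂P)) := by
    refine tendsto_lintegral_of_dominated_convergence
      (fun ω => ‖2 * Real.exp |W h ω|‖ₑ ^ (2 : ℝ)) (fun m => ?_) (fun m => ae_of_all _ fun ω => ?_)
      ?_ (ae_of_all _ fun ω => ?_)
    · have := (hc m).measurable
      fun_prop
    · refine ENNReal.rpow_le_rpow ?_ zero_le_two
      rw [enorm_le_iff_norm_le, Real.norm_eq_abs, Real.norm_eq_abs,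
        abs_of_pos (a := 2 * _) (by positivity)]
      refine (abs_sub _ _).trans ?_
      rw [abs_of_pos (Real.exp_pos _)]
      linarith [abs_expTaylor_le m (W h ω), Real.exp_le_exp.2 (le_abs_self (W h ω))]
    · have := (((hW.memLp_exp_abs h).const_mul 2).eLpNorm_lt_top)
      rw [eLpNorm_lt_top_iff_lintegral_rpow_enorm_lt_top (by simp) (by simp)] at this
      simpa using this.ne
    · have h0 := ((tendsto_const_nhds (x := Real.exp (W h ω))).sub
        (tendsto_expTaylor (W h ω))).enorm.ennrpow_const 2
      simpa using h0
  have h2 := hlim.ennrpow_const (1 / 2)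
  simpa [eLpNorm_eq_lintegral_rpow_enorm_toReal] using h2

/-- The exponential does not have polynomial growth, so 𝓔_h is reached only through the closure, by
Taylor polynomials of W(h). -/
theorem IsWhiteNoise.isMalliavinDeriv_stochExp (hW : IsWhiteNoise P W) (h : U) :
    IsMalliavinDeriv P W (stochExp W h) (fun ω => stochExp W h ω • h) := by
  refine ⟨hW.memLp_stochExp h, ?_, fun ε hε => ?_⟩
  · exact (ContinuousLinearMap.toSpanSingleton ℝ h).comp_memLp' (hW.memLp_stochExp h)
  set c : ℝ := Real.exp (-(‖h‖ ^ 2 / 2))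
  have hE : ∀ ω, stochExp W h ω = c * Real.exp (W h ω) := fun ω => by
    rw [stochExp, ← Real.exp_add]
    ring_nf
  have h0 := hW.tendsto_eLpNorm_expTaylor h
  -- Index m + 1 for the variable and m for its derivative, because differentiation lowers the
  -- Taylor index by one.
  have h1 : Filter.Tendsto (fun m => ‖c‖ₑ * eLpNorm
      (fun ω => Real.exp (W h ω) - expTaylor (m + 1) (W h ω)) 2 P) Filter.atTop (nhds 0) := by
    simpa using ENNReal.Tendsto.const_mul ((Filter.tendsto_add_atTop_iff_nat 1).2 h0)
      (Or.inr (enorm_ne_top (x := c)))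
  have h2 : Filter.Tendsto (fun m => ‖h‖ₑ * (‖c‖ₑ * eLpNorm
      (fun ω => Real.exp (W h ω) - expTaylor m (W h ω)) 2 P)) Filter.atTop (nhds 0) := by
    simpa [mul_assoc] using ENNReal.Tendsto.const_mul h0
      (Or.inr (ENNReal.mul_ne_top (enorm_ne_top (x := h)) (enorm_ne_top (x := c))))
  obtain ⟨m, hm1, hm2⟩ := ((h1.eventually (gt_mem_nhds hε)).and
    (h2.eventually (gt_mem_nhds hε))).exists
  have hd : ∀ ω, cylinderDeriv W (fun x : Fin 1 → ℝ => c * expTaylor (m + 1) (x 0))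
      (fun _ => h) ω =
      (c * expTaylor m (W h ω)) • h := fun ω => by
    have hf : HasFDerivAt (fun x : Fin 1 → ℝ => c * expTaylor (m + 1) (x 0))
        (c • (expTaylor m (W h ω) • ContinuousLinearMap.proj (R := ℝ) (φ := fun _ : Fin 1 => ℝ) 0))
        (fun _ => W h ω) :=
      ((hasDerivAt_expTaylor m (W h ω)).comp_hasFDerivAt (f := fun x : Fin 1 → ℝ => x 0)
        (fun _ => W h ω) (ContinuousLinearMap.proj (R := ℝ) (φ := fun _ : Fin 1 => ℝ) 0).hasFDerivAt).const_mul
          c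
    simp [cylinderDeriv, hf.fderiv]
  refine ⟨1, fun x => c * expTaylor (m + 1) (x 0), fun _ => h, ?_, ?_, ?_⟩
  · have := (hasTemperateGrowth_expTaylor (m + 1)).comp
      (ContinuousLinearMap.proj (R := ℝ) (φ := fun _ : Fin 1 => ℝ) 0).hasTemperateGrowth
    exact (Function.HasTemperateGrowth.const c).mul this
  · convert! hm1 using 1
    rw [← eLpNorm_const_smul]
    congr 1 with ω
    simp [cylinder, hE, mul_sub]
  · convert! hm2 using 1
    rw [← eLpNorm_const_smul]
    have : ‖h‖ₑ = ‖‖h‖‖ₑ := by simp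
    rw [this, ← eLpNorm_const_smul]
    refine eLpNorm_congr_norm_ae (ae_of_all _ fun ω => ?_)
    simp only [hd, hE, ← sub_smul, norm_smul, Pi.smul_apply, norm_norm]
    rw [← mul_sub, norm_mul]
    ring

theorem IsIteratedSkorokhod.memLp {b : HilbertBasis ι ℝ U} {n : ℕ} {G : Ω → Form U n} {g : Ω → ℝ}
    (hg : IsIteratedSkorokhod P W b n G g) : MemLp g 2 P := by
  induction n with
  | zero => exact hg.1
  | succ n ih =>
    obtain ⟨G', -, h2⟩ := hg
    exact ih h2

/-- 𝓔_h is an eigenvector of the derivative: each adjoint step puts 𝓔_h h in the last slot, and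
linearity pulls the scalar out again. -/
theorem IsWhiteNoise.integral_stochExp_mul (hW : IsWhiteNoise P W) {b : HilbertBasis ι ℝ U} (h : U)
    {n : ℕ} {G : Ω → Form U n} {g : Ω → ℝ} (hg : IsIteratedSkorokhod P W b n G g) :
    ∫ ω, stochExp W h ω * g ω ∂P = ∫ ω, stochExp W h ω * G ω (fun _ => h) ∂P := by
  induction n with
  | zero =>
    refine integral_congr_ae (hg.2.mono fun ω hω => ?_)
    simp only
    rw [hω, Subsingleton.elim Fin.elim0 (fun _ : Fin 0 => h)]
  | succ n ih =>
    obtain ⟨G', h1, h2⟩ := hg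
    rw [ih h2, h1.2.2 _ _ (hW.isMalliavinDeriv_stochExp h) (fun _ => h)]
    refine integral_congr_ae (ae_of_all _ fun ω => ?_)
    simp only
    refine ((G ω).toMultilinearMap.snoc_smul (fun _ => h) (stochExp W h ω) h).trans ?_
    refine congrArg (fun x => stochExp W h ω * G ω x) (funext fun j => ?_)
    refine Fin.lastCases ?_ (fun i => ?_) j <;> simp

theorem IsWhiteNoise.integral_finiteChaos_mul_stochExp (hW : IsWhiteNoise P W)
    {b : HilbertBasis ι ℝ U} {q : ι → ℝ} {r : ℝ} (h : U) {N : ℕ} {η : (k : ℕ) → Form U k}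
    {Y : Ω → ℝ} (hY : IsFiniteChaos P W b q r N η Y) :
    ∫ ω, Y ω * stochExp W h ω ∂P =
      ∑ k ∈ Finset.range (N + 1), (1 / (k.factorial : ℝ)) * η k (fun _ => h) := by
  obtain ⟨-, g, hg, hYg⟩ := hY
  have h1 : ∫ ω, Y ω * stochExp W h ω ∂P = ∫ ω, ∑ k ∈ Finset.range (N + 1),
      (1 / (k.factorial : ℝ)) * (stochExp W h ω * g k ω) ∂P := by
    refine integral_congr_ae (hYg.mono fun ω hω => ?_)
    simp only
    rw [hω, Finset.sum_mul]
    exact Finset.sum_congr rfl fun k _ => by ring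
  have hle : ∀ k ∈ Finset.range (N + 1), k ≤ N := fun k hk =>
    Nat.lt_succ_iff.1 (Finset.mem_range.1 hk)
  have hint : ∀ k ∈ Finset.range (N + 1), Integrable (fun ω =>
      (1 / (k.factorial : ℝ)) * (stochExp W h ω * g k ω)) P := fun k hk =>
    ((hW.memLp_stochExp h).integrable_mul (hg k (hle k hk)).memLp).const_mul _
  rw [h1, integral_finsetSum _ hint]
  refine Finset.sum_congr rfl fun k hk => ?_
  rw [integral_const_mul, hW.integral_stochExp_mul h (hg k (hle k hk)), integral_mul_const,
    hW.integral_stochExp, one_mul]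

end StochExp

/-! ### Stability of finite moments -/

section Moments

variable {Ω : Type*} [MeasurableSpace Ω] {P : Measure Ω}

/-- A real random variable with finite moments of all orders. -/
def HasAllMoments (P : Measure Ω) (Y : Ω → ℝ) : Prop := ∀ p : ℝ≥0∞, p ≠ ∞ → MemLp Y p P

theorem HasAllMoments.add {X Y : Ω → ℝ} (hX : HasAllMoments P X) (hY : HasAllMoments P Y) :
    HasAllMoments P (fun ω => X ω + Y ω) := fun p hp => (hX p hp).add (hY p hp)

theorem HasAllMoments.mul {X Y : Ω → ℝ} (hX : HasAllMoments P X) (hY : HasAllMoments P Y) :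
    HasAllMoments P (fun ω => X ω * Y ω) := fun p hp => by
  have h2 : 2 * p ≠ ∞ := ENNReal.mul_ne_top (by simp) hp
  have : ENNReal.HolderTriple (2 * p) (2 * p) p := ⟨by
    rw [ENNReal.mul_inv (by simp) (by simp), ← add_mul, ENNReal.inv_two_add_inv_two, one_mul]⟩
  exact (hY _ h2).mul' (hX _ h2)

theorem HasAllMoments.integrable {X : Ω → ℝ} (hX : HasAllMoments P X) : Integrable X P :=
  memLp_one_iff_integrable.1 (hX 1 (by simp))

theorem HasAllMoments.mono {X Y : Ω → ℝ} (hX : HasAllMoments P X) (hY : AEStronglyMeasurable Y P)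
    (hle : ∀ ω, |Y ω| ≤ X ω) : HasAllMoments P Y := fun p hp =>
  (hX p hp).mono hY (ae_of_all _ fun ω => (hle ω).trans (le_abs_self _))

theorem HasAllMoments.abs {X : Ω → ℝ} (hX : HasAllMoments P X) :
    HasAllMoments P (fun ω => |X ω|) := fun p hp => (hX p hp).norm

variable [IsFiniteMeasure P]

theorem hasAllMoments_const (c : ℝ) : HasAllMoments P (fun _ : Ω => c) := fun _ _ => memLp_const c

theorem HasAllMoments.pow {X : Ω → ℝ} (hX : HasAllMoments P X) (n : ℕ) :
    HasAllMoments P (fun ω => X ω ^ n) := by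
  induction n with
  | zero => simpa using hasAllMoments_const 1
  | succ n ih => simpa only [pow_succ] using ih.mul hX

theorem HasAllMoments.sum {κ : Type*} {X : κ → Ω → ℝ} (s : Finset κ)
    (hX : ∀ i, HasAllMoments P (X i)) : HasAllMoments P (fun ω => ∑ i ∈ s, X i ω) := by
  classical
  induction s using Finset.induction_on with
  | empty => simpa using hasAllMoments_const 0
  | insert a s ha ih => simpa only [Finset.sum_insert ha] using (hX a).add ih

theorem HasAllMoments.polynomial_eval {X : Ω → ℝ} (hX : HasAllMoments P X) (p : Polynomial ℝ) :
    HasAllMoments P (fun ω => p.eval (X ω)) := by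
  induction p using Polynomial.induction_on' with
  | add p q hp hq => simpa only [Polynomial.eval_add] using hp.add hq
  | monomial n a =>
    simpa only [Polynomial.eval_monomial] using (hasAllMoments_const a).mul (hX.pow n)

theorem HasAllMoments.comp_of_polynomial_growth {N : ℕ} {X : Fin N → Ω → ℝ}
    (hX : ∀ i, HasAllMoments P (X i)) {f : (Fin N → ℝ) → ℝ} (hf : Continuous f) {C : ℝ} {k : ℕ}
    (hle : ∀ x, |f x| ≤ C * (1 + ‖x‖) ^ k) : HasAllMoments P (fun ω => f (fun i => X i ω)) := by
  have hC : 0 ≤ C := by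
    have := (abs_nonneg _).trans (hle 0)
    simpa using this
  have hm : ∀ i, AEMeasurable (X i) P := fun i => (hX i 1 (by simp)).1.aemeasurable
  refine ((hasAllMoments_const C).mul (((hasAllMoments_const 1).add
    (HasAllMoments.sum Finset.univ fun i => (hX i).abs)).pow k)).mono
    (hf.measurable.comp_aemeasurable (aemeasurable_pi_lambda _ hm)).aestronglyMeasurable
    fun ω => (hle _).trans ?_
  have h0 : 0 ≤ ∑ i, |X i ω| := Finset.sum_nonneg fun _ _ => abs_nonneg _
  gcongr
  exact (pi_norm_le_iff_of_nonneg h0).2 fun i =>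
    Finset.single_le_sum (f := fun i => |X i ω|) (fun _ _ => abs_nonneg _) (Finset.mem_univ i)

end Moments

/-! ### Gaussian integration by parts -/

section Stein

/-- The density satisfies ρ' = -(x/v)ρ, and (ρg)' has integral zero. For v = 0 the measure is a
point mass at 0 and both sides vanish. -/
theorem integral_id_mul_gaussianReal {v : ℝ≥0} {g g' : ℝ → ℝ} (hg : ∀ x, HasDerivAt g (g' x) x)
    (h0 : Integrable g (gaussianReal 0 v)) (h1 : Integrable (fun x => x * g x) (gaussianReal 0 v))
    (h2 : Integrable g' (gaussianReal 0 v)) :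
    ∫ x, x * g x ∂(gaussianReal 0 v) = v * ∫ x, g' x ∂(gaussianReal 0 v) := by
  by_cases hv : v = 0
  · simp [hv]
  have hv' : (v : ℝ) ≠ 0 := by simpa using hv
  have hint : ∀ f : ℝ → ℝ, Integrable f (gaussianReal 0 v) →
      Integrable (fun x => gaussianPDFReal 0 v x * f x) := fun f hf => by
    rw [gaussianReal_of_var_ne_zero _ hv, integrable_withDensity_iff_integrable_smul'
      (measurable_gaussianPDF 0 v) (ae_of_all _ fun _ => gaussianPDF_lt_top)] at hf
    simpa using hf
  have hρ : ∀ x, HasDerivAt (gaussianPDFReal 0 v) (gaussianPDFReal 0 v x * (-x / v)) x :=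
      fun x => by
    rw [gaussianPDFReal_def]
    have h : HasDerivAt (fun x : ℝ => -(x - 0) ^ 2 / (2 * v)) (-x / v) x := by
      have := ((((hasDerivAt_id x).sub_const 0).pow 2).neg).div_const (2 * (v : ℝ))
      convert! this using 1
      simp
      field_simp
    convert! h.exp.const_mul _ using 1
    ring
  have hz := integral_eq_zero_of_hasDerivAt_of_integrable (fun x => (hρ x).mul (hg x))
    (f' := fun x => gaussianPDFReal 0 v x * (-x / v) * g x + gaussianPDFReal 0 v x * g' x)
    ?_ (hint g h0)
  · have hs : (fun x => gaussianPDFReal 0 v x * (-x / v) * g x + gaussianPDFReal 0 v x * g' x) =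
        fun x => (-(v : ℝ)⁻¹) * (gaussianPDFReal 0 v x * (x * g x)) +
          gaussianPDFReal 0 v x * g' x := by
      ext x
      ring
    rw [hs, integral_add ((hint _ h1).const_mul _) (hint _ h2), integral_const_mul] at hz
    simp only [integral_gaussianReal_eq_integral_smul hv, smul_eq_mul]
    rw [show ∫ x, gaussianPDFReal 0 v x * g' x =
      (v : ℝ)⁻¹ * ∫ x, gaussianPDFReal 0 v x * (x * g x) by linarith, mul_inv_cancel_left₀ hv']
  · convert! ((hint _ h1).const_mul (-(v : ℝ)⁻¹)).add (hint _ h2) using 2 with x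
    simp only [Pi.add_apply]
    ring

/-- By independence the joint law is a product, so Fubini allows the one-dimensional identity to be
used with z frozen. -/
theorem integral_mul_of_indepFun_gaussianReal {Ω : Type*} [MeasurableSpace Ω] {P : Measure Ω}
    [IsProbabilityMeasure P] {E : Type*} [MeasurableSpace E] {v : ℝ≥0} {X : Ω → ℝ} {Z : Ω → E}
    (hX : Measurable X) (hZ : Measurable Z) (hlaw : P.map X = gaussianReal 0 v)
    (hind : IndepFun Z X P) {Φ Φ' : E × ℝ → ℝ} (hΦ : Measurable Φ) (hΦ' : Measurable Φ')
    (hderiv : ∀ z x, HasDerivAt (fun x => Φ (z, x)) (Φ' (z, x)) x)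
    (h0 : Integrable (fun ω => Φ (Z ω, X ω)) P)
    (h1 : Integrable (fun ω => X ω * Φ (Z ω, X ω)) P)
    (h2 : Integrable (fun ω => Φ' (Z ω, X ω)) P) :
    ∫ ω, X ω * Φ (Z ω, X ω) ∂P = v * ∫ ω, Φ' (Z ω, X ω) ∂P := by
  have hZX : Measurable fun ω => (Z ω, X ω) := hZ.prodMk hX
  have hmap : P.map (fun ω => (Z ω, X ω)) = (P.map Z).prod (gaussianReal 0 v) := by
    rw [← hlaw]
    exact (indepFun_iff_map_prod_eq_prod_map_map hZ.aemeasurable hX.aemeasurable).1 hind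
  have : IsProbabilityMeasure (P.map Z) := Measure.isProbabilityMeasure_map hZ.aemeasurable
  have hΦ1 : Measurable fun y : E × ℝ => y.2 * Φ y := measurable_snd.mul hΦ
  have key : ∀ Ψ : E × ℝ → ℝ, Measurable Ψ → Integrable (fun ω => Ψ (Z ω, X ω)) P →
      Integrable Ψ ((P.map Z).prod (gaussianReal 0 v)) ∧
      ∫ ω, Ψ (Z ω, X ω) ∂P = ∫ z, ∫ x, Ψ (z, x) ∂(gaussianReal 0 v) ∂(P.map Z) := by
    intro Ψ hΨ hi
    have hi' : Integrable Ψ ((P.map Z).prod (gaussianReal 0 v)) := by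
      rw [← hmap]
      exact (integrable_map_measure hΨ.aestronglyMeasurable hZX.aemeasurable).2 hi
    refine ⟨hi', ?_⟩
    rw [← integral_prod _ hi', ← hmap,
      integral_map hZX.aemeasurable hΨ.aestronglyMeasurable]
  obtain ⟨i0, -⟩ := key Φ hΦ h0
  obtain ⟨i1, e1⟩ := key _ hΦ1 h1
  obtain ⟨i2, e2⟩ := key Φ' hΦ' h2
  simp only at e1
  rw [e1, e2, ← integral_const_mul]
  refine integral_congr_ae ?_
  filter_upwards [i0.prod_right_ae, i1.prod_right_ae, i2.prod_right_ae] with z a0 a1 a2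
  exact integral_id_mul_gaussianReal (hderiv z) a0 a1 a2

end Stein

/-! ### Integration by parts on the white noise space -/

section IntegrationByParts

variable {Ω : Type*} [MeasurableSpace Ω] {P : Measure Ω}
  {U : Type*} [NormedAddCommGroup U] [InnerProductSpace ℝ U] {ι : Type*} {W : U → Ω → ℝ}

theorem IsWhiteNoise.hasAllMoments (hW : IsWhiteNoise P W) (h : U) : HasAllMoments P (W h) :=
  fun _ hp => (hW.gaussian.hasGaussianLaw_eval h).memLp hp

/-- The residual of projecting onto W(u) is uncorrelated with W(u), and joint Gaussianity upgrades
this to independence. The division-free condition on a also covers u = 0. -/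
theorem IsWhiteNoise.indepFun_residual [IsProbabilityMeasure P] (hW : IsWhiteNoise P W)
    (u : U) {N : ℕ} (h : Fin N → U) {a : Fin N → ℝ} (ha : ∀ i, a i * ‖u‖ ^ 2 = inner ℝ (h i) u) :
    IndepFun (fun ω i => W (h i) ω - a i * W u ω) (W u) P := by
  classical
  have hm := hW.measurable
  have hG : IsGaussianProcess (Sum.elim (fun i ω => W (h i) ω - a i * W u ω)
      (fun _ : Unit => W u)) P := by
    refine hW.gaussian.of_isGaussianProcess fun s => ?_
    rcases s with i | i
    · exact ⟨{h i, u},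
        { toFun := fun x => x ⟨h i, by simp⟩ - a i * x ⟨u, by simp⟩
          map_add' := fun x y => by simp; ring
          map_smul' := fun c x => by simp; ring }, fun ω => by simp⟩
    · exact ⟨{u}, ContinuousLinearMap.proj ⟨u, by simp⟩, fun ω => by simp⟩
  have hi := hG.indepFun_of_covariance_eq_zero (fun s => by fun_prop) (fun s => by fun_prop)
    fun i _ => ?_
  · exact hi.comp measurable_id (measurable_pi_apply ())
  · have h2 : ∀ h, MemLp (W h) 2 P := fun h => hW.hasAllMoments h 2 (by simp)
    rw [covariance_fun_sub_left (h2 _) ((h2 u).const_mul _) (h2 u), covariance_const_mul_left,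
      covariance_eq_sub (h2 _) (h2 u), covariance_eq_sub (h2 u) (h2 u)]
    simp only [hW.mean_zero, Pi.mul_apply, hW.covariance, real_inner_self_eq_norm_sq]
    linarith [ha i]

/-- The adjoint of `p ↦ p'` for the centred Gaussian measure of variance `v`. -/
noncomputable def hermiteRaise (v : ℝ) (p : Polynomial ℝ) : Polynomial ℝ :=
  Polynomial.X * p - Polynomial.C v * Polynomial.derivative p

theorem IsWhiteNoise.hasAllMoments_cylinder [IsProbabilityMeasure P] (hW : IsWhiteNoise P W) {N : ℕ}
    {f : (Fin N → ℝ) → ℝ} (hf : f.HasTemperateGrowth) (h : Fin N → U) :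
    HasAllMoments P (cylinder W f h) := by
  obtain ⟨k, C, hC⟩ := hf.2 0
  exact HasAllMoments.comp_of_polynomial_growth (fun i => hW.hasAllMoments (h i))
    hf.1.continuous (C := C) (k := k) fun x => by simpa using hC x

theorem IsWhiteNoise.hasAllMoments_fderiv [IsProbabilityMeasure P] (hW : IsWhiteNoise P W) {N : ℕ}
    {f : (Fin N → ℝ) → ℝ} (hf : f.HasTemperateGrowth) (h : Fin N → U) (a : Fin N → ℝ) :
    HasAllMoments P (fun ω => fderiv ℝ f (fun j => W (h j) ω) a) := by
  obtain ⟨k, C, hC⟩ := hf.2 1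
  refine HasAllMoments.comp_of_polynomial_growth (f := fun x => fderiv ℝ f x a)
    (fun i => hW.hasAllMoments (h i)) ((hf.1.continuous_fderiv (by simp)).clm_apply
      continuous_const) (C := ‖a‖ * C) (k := k) fun x => ?_
  refine ((fderiv ℝ f x).le_opNorm a).trans ?_
  rw [← norm_iteratedFDeriv_one, mul_comm, mul_assoc]
  gcongr
  exact hC x

theorem inner_cylinderDeriv {Ω : Type*} {W : U → Ω → ℝ} (u : U) {N : ℕ} (f : (Fin N → ℝ) → ℝ)
    (h : Fin N → U) {a : Fin N → ℝ} (ha : ∀ i, a i * ‖u‖ ^ 2 = inner ℝ (h i) u) (ω : Ω) :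
    inner ℝ u (cylinderDeriv W f h ω) = ‖u‖ ^ 2 * fderiv ℝ f (fun j => W (h j) ω) a := by
  rw [cylinderDeriv, inner_sum]
  conv_rhs => rw [← Finset.univ_sum_single a, map_sum, Finset.mul_sum]
  refine Finset.sum_congr rfl fun i _ => ?_
  have : (Pi.single i (a i) : Fin N → ℝ) = a i • Pi.single i 1 := by
    rw [← Pi.single_smul, smul_eq_mul, mul_one]
  rw [this, map_smul, inner_smul_right, real_inner_comm, ← ha, smul_eq_mul]
  ring

theorem IsWhiteNoise.memLp_cylinderDeriv [IsProbabilityMeasure P] (hW : IsWhiteNoise P W) {N : ℕ}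
    {f : (Fin N → ℝ) → ℝ} (hf : f.HasTemperateGrowth) (h : Fin N → U) :
    MemLp (cylinderDeriv W f h) 2 P := by
  unfold cylinderDeriv
  exact memLp_finsetSum _ fun i _ => (ContinuousLinearMap.toSpanSingleton ℝ (h i)).comp_memLp'
    (hW.hasAllMoments_fderiv hf h (Pi.single i 1) 2 (by simp))

/-- Write (W(h_i)) = Z + W(u)a with Z independent of W(u), and apply Stein's identity to x ↦ f(Z +
xa)p(x). The p' term moves to the left and completes `hermiteRaise`; the term ‖u‖² ∂_a f is (u, DF),
where F is the cylinder variable. -/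
theorem IsWhiteNoise.integral_cylinder_mul_hermiteRaise [IsProbabilityMeasure P]
    (hW : IsWhiteNoise P W) (u : U) (p : Polynomial ℝ) {N : ℕ} {f : (Fin N → ℝ) → ℝ}
    (hf : f.HasTemperateGrowth) (h : Fin N → U) :
    ∫ ω, cylinder W f h ω * (hermiteRaise (‖u‖ ^ 2) p).eval (W u ω) ∂P =
      ∫ ω, p.eval (W u ω) * inner ℝ u (cylinderDeriv W f h ω) ∂P := by
  have hm := hW.measurable
  set a : Fin N → ℝ := fun i => inner ℝ (h i) u / ‖u‖ ^ 2
  have ha : ∀ i, a i * ‖u‖ ^ 2 = inner ℝ (h i) u := fun i => by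
    rcases eq_or_ne u 0 with rfl | hu
    · simp
    · exact div_mul_cancel₀ _ (by positivity)
  have hdf : Differentiable ℝ f := hf.1.differentiable (by simp)
  have hcf : Continuous fun x => fderiv ℝ f x a :=
    (hf.1.continuous_fderiv (by simp)).clm_apply continuous_const
  have hF : HasAllMoments P (fun ω => f (fun i => W (h i) ω)) := hW.hasAllMoments_cylinder hf h
  have hF' := hW.hasAllMoments_fderiv hf h a
  have hp := (hW.hasAllMoments u).polynomial_eval p
  have hp' := (hW.hasAllMoments u).polynomial_eval (Polynomial.derivative p)
  have key := integral_mul_of_indepFun_gaussianReal (P := P) (X := W u)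
    (Z := fun ω i => W (h i) ω - a i * W u ω)
    (Φ := fun y => f (y.1 + y.2 • a) * p.eval y.2)
    (Φ' := fun y => fderiv ℝ f (y.1 + y.2 • a) a * p.eval y.2 +
      f (y.1 + y.2 • a) * (Polynomial.derivative p).eval y.2)
    (hm u) (by fun_prop) (hW.map_eq u) (hW.indepFun_residual u h ha) ?_ ?_ ?_
  · have hZ : ∀ ω, (fun i => W (h i) ω - a i * W u ω) + W u ω • a = fun i => W (h i) ω :=
        fun ω => by
      ext i
      simp [mul_comm]
    simp only [hZ, Real.coe_toNNReal _ (sq_nonneg ‖u‖)] at key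
    have e := key (hF.mul hp).integrable ((hW.hasAllMoments u).mul (hF.mul hp)).integrable
      ((hF'.mul hp).add (hF.mul hp')).integrable
    rw [integral_add (hF'.mul hp).integrable (hF.mul hp').integrable] at e
    simp only [inner_cylinderDeriv u f h ha, hermiteRaise, Polynomial.eval_sub, Polynomial.eval_mul,
      Polynomial.eval_X, Polynomial.eval_C]
    have e1 : ∀ ω, cylinder W f h ω * (W u ω * p.eval (W u ω) -
        ‖u‖ ^ 2 * (Polynomial.derivative p).eval (W u ω)) =
        W u ω * (f (fun i => W (h i) ω) * p.eval (W u ω)) -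
          ‖u‖ ^ 2 * (f (fun i => W (h i) ω) * (Polynomial.derivative p).eval (W u ω)) := fun ω => by
      rw [cylinder]
      ring
    have e2 : ∀ ω, p.eval (W u ω) * (‖u‖ ^ 2 * fderiv ℝ f (fun j => W (h j) ω) a) =
        ‖u‖ ^ 2 * (fderiv ℝ f (fun j => W (h j) ω) a * p.eval (W u ω)) := fun ω => by ring
    simp_rw [e1, e2]
    rw [integral_sub ((hW.hasAllMoments u).mul (hF.mul hp)).integrable
      ((hF.mul hp').integrable.const_mul _), integral_const_mul, integral_const_mul]
    rw [e]
    ring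
  · have := hdf.continuous
    have := p.continuous
    exact Continuous.measurable (by fun_prop)
  · have := hdf.continuous
    have := p.continuous
    have := (Polynomial.derivative p).continuous
    exact Continuous.measurable (by fun_prop)
  · intro z x
    have h1 : HasDerivAt (fun x : ℝ => z + x • a) a x := by
      simpa using ((hasDerivAt_id x).smul_const a).const_add z
    exact ((hdf _).hasFDerivAt.comp_hasDerivAt x h1).mul (p.hasDerivAt x)

theorem enorm_integral_inner_le {E : Type*} [NormedAddCommGroup E] [InnerProductSpace ℝ E]
    {f g : Ω → E} (hf : AEStronglyMeasurable f P) (hg : AEStronglyMeasurable g P) :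
    ‖∫ ω, inner ℝ (f ω) (g ω) ∂P‖ₑ ≤ eLpNorm f 2 P * eLpNorm g 2 P := by
  refine (enorm_integral_le_lintegral_enorm _).trans ?_
  rw [← eLpNorm_one_eq_lintegral_enorm]
  simpa using eLpNorm_le_eLpNorm_mul_eLpNorm_of_nnnorm (p := 2) (q := 2) (r := 1) hf hg
    (fun x y => (inner ℝ x y : ℝ)) 1
    (ae_of_all _ fun ω => by simpa using nnnorm_inner_le_nnnorm (𝕜 := ℝ) (f ω) (g ω))

theorem integrable_mul_inner {u : U} {Y : Ω → ℝ} {D : Ω → U} (hY : MemLp Y 2 P)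
    (hD : MemLp D 2 P) : Integrable (fun ω => Y ω * inner ℝ u (D ω)) P :=
  hY.integrable_mul ((innerSL ℝ u).comp_memLp' hD)

/-- Both sides are L₂-continuous in the pair (φ, Dφ), so the identity passes from cylinder variables
to the closure. -/
theorem IsWhiteNoise.integral_mul_hermiteRaise [IsProbabilityMeasure P] (hW : IsWhiteNoise P W)
    (u : U) (p : Polynomial ℝ) {φ : Ω → ℝ} {Dφ : Ω → U} (hφ : IsMalliavinDeriv P W φ Dφ) :
    ∫ ω, φ ω * (hermiteRaise (‖u‖ ^ 2) p).eval (W u ω) ∂P =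
      ∫ ω, p.eval (W u ω) * inner ℝ u (Dφ ω) ∂P := by
  obtain ⟨hφ2, hD2, happrox⟩ := hφ
  set Q : Ω → ℝ := fun ω => (hermiteRaise (‖u‖ ^ 2) p).eval (W u ω)
  set R : Ω → ℝ := fun ω => p.eval (W u ω)
  have hQ : MemLp Q 2 P := (hW.hasAllMoments u).polynomial_eval _ 2 (by simp)
  have hR : MemLp R 2 P := (hW.hasAllMoments u).polynomial_eval _ 2 (by simp)
  have hRu : MemLp (fun ω => R ω • u) 2 P :=
    (ContinuousLinearMap.toSpanSingleton ℝ u).comp_memLp' hR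
  rw [← sub_eq_zero, ← enorm_eq_zero, ← nonpos_iff_eq_zero]
  have hlim : Filter.Tendsto (fun n : ℕ => (n : ℝ≥0∞)⁻¹ *
      (eLpNorm Q 2 P + eLpNorm (fun ω => R ω • u) 2 P)) Filter.atTop (nhds 0) := by
    simpa using ENNReal.Tendsto.mul_const ENNReal.tendsto_inv_nat_nhds_zero
      (Or.inr (ENNReal.add_ne_top.2 ⟨hQ.eLpNorm_ne_top, hRu.eLpNorm_ne_top⟩))
  refine ge_of_tendsto' hlim fun n => ?_
  obtain ⟨N, f, h, hf, h1, h2⟩ := happrox (n : ℝ≥0∞)⁻¹ (by simp)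
  have hF : MemLp (cylinder W f h) 2 P := hW.hasAllMoments_cylinder hf h 2 (by simp)
  have hDF := hW.memLp_cylinderDeriv hf h
  -- The cylinder identity cancels, leaving only the approximation errors, each below 1/n in L₂.
  have e1 : ∫ ω, φ ω * Q ω ∂P - ∫ ω, R ω * inner ℝ u (Dφ ω) ∂P =
      ∫ ω, inner ℝ (Q ω) (φ ω - cylinder W f h ω) ∂P -
        ∫ ω, inner ℝ (R ω • u) (Dφ ω - cylinderDeriv W f h ω) ∂P := by
    simp only [inner_sub_right, real_inner_smul_left, RCLike.inner_apply, conj_trivial]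
    have i1 : Integrable (fun ω => φ ω * Q ω) P := hφ2.integrable_mul hQ
    have i2 : Integrable (fun ω => cylinder W f h ω * Q ω) P := hF.integrable_mul hQ
    simp_rw [sub_mul]
    rw [integral_sub i1 i2,
      integral_sub (integrable_mul_inner hR hD2) (integrable_mul_inner hR hDF),
      hW.integral_cylinder_mul_hermiteRaise u p hf h]
    ring
  rw [e1]
  refine (enorm_sub_le).trans ?_
  rw [mul_add]
  gcongr
  · refine (enorm_integral_inner_le hQ.1 (hφ2.sub hF).1).trans ?_
    rw [mul_comm]
    exact mul_le_mul_left h1.le _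
  · refine (enorm_integral_inner_le hRu.1 (hD2.sub hDF).1).trans ?_
    rw [mul_comm]
    exact mul_le_mul_left h2.le _

end IntegrationByParts

/-! ### Iterated Skorokhod integrals of pure powers -/

section Iterated

variable {Ω : Type*} [MeasurableSpace Ω] {P : Measure Ω}
  {U : Type*} [NormedAddCommGroup U] [InnerProductSpace ℝ U] {ι : Type*} {W : U → Ω → ℝ}

theorem isL2Tensor_smul_powForm (b : HilbertBasis ι ℝ U) (u : U) (n : ℕ) {Y : Ω → ℝ}
    (hY : MemLp Y 2 P) : IsL2Tensor P b (fun ω => Y ω • powForm u n) := by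
  refine ⟨fun x => by simpa using hY.1.mul_const _, ?_⟩
  simp only [tensorSq_smul_powForm]
  rw [lintegral_mul_const' _ _ (ENNReal.pow_ne_top ENNReal.ofReal_ne_top)]
  exact ENNReal.mul_lt_top hY.integrable_sq.lintegral_lt_top
    (ENNReal.pow_lt_top ENNReal.ofReal_lt_top)

theorem IsWhiteNoise.isSkorokhod_hermiteRaise [IsProbabilityMeasure P] (hW : IsWhiteNoise P W)
    (b : HilbertBasis ι ℝ U) (u : U) (n : ℕ) (p : Polynomial ℝ) :
    IsSkorokhod P W b (fun ω => p.eval (W u ω) • powForm u (n + 1))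
      (fun ω => (hermiteRaise (‖u‖ ^ 2) p).eval (W u ω) • powForm u n) := by
  have hm : ∀ p : Polynomial ℝ, MemLp (fun ω => p.eval (W u ω)) 2 P := fun p =>
    (hW.hasAllMoments u).polynomial_eval p 2 (by simp)
  refine ⟨isL2Tensor_smul_powForm b u _ (hm _), isL2Tensor_smul_powForm b u _ (hm _),
    fun φ Dφ hφ x => ?_⟩
  simp only [smul_apply, smul_eq_mul, powForm_snoc]
  simp_rw [← mul_assoc, mul_right_comm _ (powForm u n x)]
  rw [integral_mul_const, integral_mul_const, hW.integral_mul_hermiteRaise u p hφ]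

/-- Each integration trades one factor u for one raising of the polynomial. The induction needs
arbitrary p since the integrand is random after the first step; constant p gives multiples of
Hermite polynomials. -/
theorem IsWhiteNoise.isIteratedSkorokhod_powForm [IsProbabilityMeasure P] (hW : IsWhiteNoise P W)
    (b : HilbertBasis ι ℝ U) (u : U) (n : ℕ) (p : Polynomial ℝ) :
    IsIteratedSkorokhod P W b n (fun ω => p.eval (W u ω) • powForm u n)
      (fun ω => ((hermiteRaise (‖u‖ ^ 2))^[n] p).eval (W u ω)) := by
  induction n generalizing p with
  | zero =>
    exact ⟨(hW.hasAllMoments u).polynomial_eval p 2 (by simp), ae_of_all _ fun ω => by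
      simp [powForm_apply]⟩
  | succ n ih => exact ⟨_, hW.isSkorokhod_hermiteRaise b u n p, ih _⟩

end Iterated

/-! ### Boundedness of the functional -/

section Dual

variable {U : Type*} [NormedAddCommGroup U] [InnerProductSpace ℝ U] {ι : Type*}

theorem normQ_lt_one_iff (b : HilbertBasis ι ℝ U) (q : ι → ℝ) (r : ℝ) (h : U) :
    normQ b q r h < 1 ↔ ∑' k, ENNReal.ofReal ((q k ^ r * inner ℝ (b k) h) ^ 2) < 1 := by
  rw [normQ]
  conv_lhs => rw [← ENNReal.one_rpow (1 / 2)]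
  exact ENNReal.rpow_lt_rpow_iff (by norm_num)

/-- The diagonal bound termwise, then Cauchy–Schwarz over k; the constant is the root of the
geometric series, possibly ∞. -/
theorem ofReal_abs_sum_diagonal_le (b : HilbertBasis ι ℝ U) {q : ι → ℝ} (hq : ∀ k, 0 < q k) (r : ℝ)
    (h : U) (N : ℕ) (η : (k : ℕ) → Form U k) :
    ENNReal.ofReal |∑ k ∈ Finset.range (N + 1), (1 / (k.factorial : ℝ)) * η k (fun _ => h)| ≤
      ((1 - ∑' k, ENNReal.ofReal ((q k ^ (-r) * inner ℝ (b k) h) ^ 2))⁻¹) ^ (1 / 2 : ℝ) *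
        chaosNorm b q r N η := by
  set a := ∑' k, ENNReal.ofReal ((q k ^ (-r) * inner ℝ (b k) h) ^ 2)
  set c : ℕ → ℝ≥0∞ := fun k =>
    ENNReal.ofReal ((1 / (k.factorial : ℝ)) ^ 2) * weightedSq b q r (η k)
  have hterm : ∀ k, ENNReal.ofReal |(1 / (k.factorial : ℝ)) * η k (fun _ => h)| ≤
      (c k) ^ (1 / 2 : ℝ) * (a ^ k) ^ (1 / 2 : ℝ) := fun k => by
    rw [← ENNReal.mul_rpow_of_nonneg _ _ (by norm_num)]
    have h1 : ENNReal.ofReal |(1 / (k.factorial : ℝ)) * η k (fun _ => h)| =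
        (ENNReal.ofReal (((1 / (k.factorial : ℝ)) * η k (fun _ => h)) ^ 2)) ^ (1 / 2 : ℝ) := by
      rw [ENNReal.ofReal_rpow_of_nonneg (sq_nonneg _) (by norm_num), ← Real.sqrt_eq_rpow,
        Real.sqrt_sq_eq_abs]
    rw [h1, mul_pow, ENNReal.ofReal_mul (sq_nonneg _), mul_assoc]
    gcongr
    exact ofReal_sq_diagonal_le b hq r (η k) h
  calc ENNReal.ofReal |∑ k ∈ Finset.range (N + 1), (1 / (k.factorial : ℝ)) * η k (fun _ => h)|
      ≤ ∑ k ∈ Finset.range (N + 1),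
          ENNReal.ofReal |(1 / (k.factorial : ℝ)) * η k (fun _ => h)| := by
        rw [← ENNReal.ofReal_sum_of_nonneg fun _ _ => abs_nonneg _]
        exact ENNReal.ofReal_le_ofReal (Finset.abs_sum_le_sum_abs _ _)
    _ ≤ ∑ k ∈ Finset.range (N + 1), (c k) ^ (1 / 2 : ℝ) * (a ^ k) ^ (1 / 2 : ℝ) :=
        Finset.sum_le_sum fun k _ => hterm k
    _ ≤ (∑ k ∈ Finset.range (N + 1), c k) ^ (1 / 2 : ℝ) *
          (∑ k ∈ Finset.range (N + 1), a ^ k) ^ (1 / 2 : ℝ) := by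
        have := ENNReal.inner_le_Lp_mul_Lq (Finset.range (N + 1)) (fun k => (c k) ^ (1 / 2 : ℝ))
          (fun k => (a ^ k) ^ (1 / 2 : ℝ)) Real.HolderConjugate.two_two
        simpa only [← ENNReal.rpow_mul, one_div, inv_mul_cancel₀ (two_ne_zero' ℝ),
          ENNReal.rpow_one] using this
    _ ≤ _ := by
        rw [mul_comm]
        gcongr ?_ ^ (1 / 2 : ℝ) * _
        rw [← ENNReal.tsum_geometric]
        exact ENNReal.sum_le_tsum _

variable {Ω : Type*} [MeasurableSpace Ω] {P : Measure Ω} {W : U → Ω → ℝ}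

theorem IsWhiteNoise.memDual_stochExp (hW : IsWhiteNoise P W) (b : HilbertBasis ι ℝ U) {q : ι → ℝ}
    (hq : ∀ k, 0 < q k) (r : ℝ) {h : U} (hh : normQ b q (-r) h < 1) :
    MemDual P W b q r (stochExp W h) := by
  rw [normQ_lt_one_iff] at hh
  refine ⟨hW.memLp_stochExp h,
    (((1 - ∑' k, ENNReal.ofReal ((q k ^ (-r) * inner ℝ (b k) h) ^ 2))⁻¹) ^
      (1 / 2 : ℝ)).toNNReal, fun N η Y hY => ?_⟩
  rw [hW.integral_finiteChaos_mul_stochExp h hY, ENNReal.coe_toNNReal]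
  · exact ofReal_abs_sum_diagonal_le b hq r h N η
  · exact ENNReal.rpow_ne_top_of_nonneg (by norm_num)
      (ENNReal.inv_ne_top.2 (tsub_pos_of_lt hh).ne')

theorem IsWhiteNoise.isFiniteChaos_powForm [IsProbabilityMeasure P] (hW : IsWhiteNoise P W)
    (b : HilbertBasis ι ℝ U) (q : ι → ℝ) (r : ℝ) (u : U)
    (hu : ∑' k, ENNReal.ofReal ((q k ^ r * inner ℝ u (b k)) ^ 2) < ∞) (c : ℕ → ℝ) (N : ℕ) :
    ∃ Y, IsFiniteChaos P W b q r N (fun k => c k • powForm u k) Y :=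
  ⟨_, fun k _ => isKernel_smul_powForm b q r (c k) u k hu,
    fun k ω => ((hermiteRaise (‖u‖ ^ 2))^[k] (Polynomial.C (c k))).eval (W u ω),
    fun k _ => by simpa using hW.isIteratedSkorokhod_powForm b u k (Polynomial.C (c k)),
    ae_of_all _ fun _ => rfl⟩

/-- The extremal vector for Cauchy–Schwarz is Λ_Q^{-2r}h. Truncating to s is needed because h may
lie outside the domain of Λ_Q^{-2r}. -/
theorem exists_truncated_dual (b : HilbertBasis ι ℝ U) {q : ι → ℝ}
    (hq : ∀ k, 0 < q k) (r : ℝ) (h : U) (s : Finset ι) :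
    ∃ u : U, inner ℝ u h = ∑ k ∈ s, (q k ^ (-r) * inner ℝ (b k) h) ^ 2 ∧
      ∑' k, ENNReal.ofReal ((q k ^ r * inner ℝ u (b k)) ^ 2) =
        ENNReal.ofReal (∑ k ∈ s, (q k ^ (-r) * inner ℝ (b k) h) ^ 2) := by
  classical
  refine ⟨∑ k ∈ s, ((q k ^ (-r)) ^ 2 * inner ℝ (b k) h) • b k, ?_, ?_⟩
  · rw [sum_inner]
    refine Finset.sum_congr rfl fun k _ => ?_
    rw [real_inner_smul_left]
    ring
  · have hin : ∀ k, inner ℝ (∑ k ∈ s, ((q k ^ (-r)) ^ 2 * inner ℝ (b k) h) • b k) (b k) =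
        if k ∈ s then (q k ^ (-r)) ^ 2 * inner ℝ (b k) h else (0 : ℝ) := fun k => by
      rw [sum_inner]
      simp only [real_inner_smul_left, orthonormal_iff_ite.1 b.orthonormal, mul_ite, mul_one,
        mul_zero, Finset.sum_ite_eq']
    rw [ENNReal.ofReal_sum_of_nonneg fun _ _ => sq_nonneg _, tsum_eq_sum (s := s)]
    · refine Finset.sum_congr rfl fun k hk => ?_
      rw [hin, if_pos hk]
      have h1 : q k ^ r * q k ^ (-r) = 1 := by
        rw [← Real.rpow_add (hq k), add_neg_cancel, Real.rpow_zero]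
      congr 2
      linear_combination (q k ^ (-r) * inner ℝ (b k) h) * h1
    · intro k hk
      simp [hin, hk]

theorem IsWhiteNoise.normQ_lt_one_of_memDual [IsProbabilityMeasure P] (hW : IsWhiteNoise P W)
    (b : HilbertBasis ι ℝ U) {q : ι → ℝ} (hq : ∀ k, 0 < q k) (r : ℝ) {h : U}
    (hh : MemDual P W b q r (stochExp W h)) :
    normQ b q (-r) h < 1 := by
  rw [normQ_lt_one_iff]
  obtain ⟨-, C, hC⟩ := hh
  have hfin : ∀ (N : ℕ) (s : Finset ι), ∑ k ∈ Finset.range (N + 1),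
      (∑ i ∈ s, ENNReal.ofReal ((q i ^ (-r) * inner ℝ (b i) h) ^ 2)) ^ k ≤ (C : ℝ≥0∞) ^ 2 := by
    intro N s
    obtain ⟨u, hu1, hu2⟩ := exists_truncated_dual b hq r h s
    set a : ℝ := ∑ k ∈ s, (q k ^ (-r) * inner ℝ (b k) h) ^ 2
    have ha : 0 ≤ a := Finset.sum_nonneg fun _ _ => sq_nonneg _
    -- With coefficients k!, all factorials cancel: the functional and the squared norm both equal S
    -- = ∑_{k≤N} aᵏ.
    obtain ⟨Y, hY⟩ := hW.isFiniteChaos_powForm b q r u (hu2 ▸ ENNReal.ofReal_lt_top)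
      (fun k => (k.factorial : ℝ)) N
    have hb := hC N _ Y hY
    have hfac : ∀ k : ℕ, (k.factorial : ℝ) ≠ 0 := fun k => by positivity
    have hcancel : ∀ k : ℕ, ENNReal.ofReal ((1 / (k.factorial : ℝ)) ^ 2) *
        (ENNReal.ofReal ((k.factorial : ℝ) ^ 2) * ENNReal.ofReal a ^ k) = ENNReal.ofReal a ^ k :=
      fun k => by
        rw [← mul_assoc, ← ENNReal.ofReal_mul (sq_nonneg _), ← mul_pow, one_div_mul_cancel (hfac k)]
        simp
    rw [hW.integral_finiteChaos_mul_stochExp h hY, chaosNorm] at hb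
    simp only [weightedSq_smul_powForm, hu2, hcancel, smul_apply, powForm_apply, hu1,
      Finset.prod_const, Finset.card_univ, Fintype.card_fin, smul_eq_mul] at hb
    simp only [← mul_assoc, one_div_mul_cancel (hfac _), one_mul] at hb
    rw [abs_of_nonneg (Finset.sum_nonneg fun k _ => pow_nonneg ha k),
      ENNReal.ofReal_sum_of_nonneg fun k _ => pow_nonneg ha k] at hb
    simp only [ENNReal.ofReal_pow ha] at hb
    rw [← ENNReal.ofReal_sum_of_nonneg fun _ _ => sq_nonneg _]
    set S := ∑ k ∈ Finset.range (N + 1), ENNReal.ofReal a ^ k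
    have hS0 : S ≠ 0 := by
      have : (1 : ℝ≥0∞) ≤ S := by
        simpa using Finset.single_le_sum (f := fun k => ENNReal.ofReal a ^ k)
          (fun _ _ => zero_le) (Finset.mem_range.2 N.succ_pos)
      exact (zero_lt_one.trans_le this).ne'
    have hStop : S ≠ ∞ := ENNReal.sum_ne_top.2 fun k _ => ENNReal.pow_ne_top ENNReal.ofReal_ne_top
    -- This is S ≤ C S^{1/2} squared; S is finite and its k = 0 term makes it nonzero, so one factor
    -- cancels.
    have hsq : S * S ≤ C ^ 2 * S := by
      have h2 := mul_le_mul' hb hb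
      rwa [mul_mul_mul_comm, ← ENNReal.rpow_add _ _ hS0 hStop, add_halves, ENNReal.rpow_one,
        ← sq (C : ℝ≥0∞)] at h2
    exact (ENNReal.mul_le_mul_iff_left hS0 hStop).1 hsq
  by_contra! hge
  -- Letting s exhaust the index set for fixed N reaches the full sum even if it is ∞; when it is at
  -- least 1, each of the N + 1 powers is at least 1.
  have hbd : ∀ N : ℕ, ((N + 1 : ℕ) : ℝ≥0∞) ≤ (C : ℝ≥0∞) ^ 2 := fun N => by
    have hcont : Continuous fun x : ℝ≥0∞ => ∑ k ∈ Finset.range (N + 1), x ^ k := by fun_prop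
    refine le_trans ?_ (le_of_tendsto' ((hcont.tendsto _).comp ENNReal.summable.hasSum) (hfin N))
    calc ((N + 1 : ℕ) : ℝ≥0∞) = ∑ k ∈ Finset.range (N + 1), 1 := by simp
      _ ≤ _ := Finset.sum_le_sum fun k _ => one_le_pow₀ hge
  obtain ⟨N, hN⟩ := ENNReal.exists_nat_gt (ENNReal.pow_ne_top (n := 2)
    (ENNReal.coe_ne_top (r := C)))
  exact absurd (hN.trans_le ((Nat.cast_le.2 N.le_succ).trans (hbd N))) (lt_irrefl _)

end Dual

end WhiteNoise

theorem proposition3p1 {Ω : Type*} [MeasurableSpace Ω] (P : Measure Ω) [IsProbabilityMeasure P]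
    {U : Type*} [NormedAddCommGroup U] [InnerProductSpace ℝ U] [CompleteSpace U]
    {ι : Type*} [Countable ι] (b : HilbertBasis ι ℝ U)
    (W : U → Ω → ℝ) (hW : WhiteNoise.IsWhiteNoise P W)
    (q : ι → ℝ) (hq : WhiteNoise.IsWeight q) (r : ℝ) (h : U) :
    WhiteNoise.MemDual P W b q r (WhiteNoise.stochExp W h) ↔
      WhiteNoise.normQ b q (-r) h < 1 := by
  have hq0 : ∀ k, 0 < q k := fun k => zero_lt_one.trans_le (hq k)
  exact ⟨hW.normQ_lt_one_of_memDual b hq0 r, hW.memDual_stochExp b hq0 r⟩
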